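/- Let $\mathbf{Top}$ be the category of compactly generated weakly Hausdorff spaces, with its cartesian product (the compactly generated product). Fix a set $\mathcal{O}$. Let $\mathcal{O}\text{-}\mathbf{Cat}_{\mathbf{Top}}$ be the category of small categories enriched in $\mathbf{Top}$ with set of objects $\mathcal{O}$, whose morphisms are the enriched functors that are the identity on objects. Let $\mathcal{O}\text{-}\mathbf{Graph}_{\mathbf{Top}}$ be the category of families $(\Gamma(a,b))_{a,b\in\mathcal{O}}$ of objects of $\mathbf{Top}$, with families of continuous maps as morphisms. A morphism $F:\mathbf{C}\to\mathbf{D}$ of $\mathcal{O}\text{-}\mathbf{Cat}_{\mathbf{Top}}$ is a weak equivalence if $\mathbf{Map}_{\mathbf{C}}(a,b)\to\mathbf{Map}_{\mathbf{D}}(a,b)$ is a weak homotopy equivalence for all $a,b\in\mathcal{O}$, and $\pi_0F:\pi_0\mathbf{C}\to\pi_0\mathbf{D}$ is an equivalence of categories. The free product $\star$ is the coproduct in $\mathcal{O}\text{-}\mathbf{Cat}_{\mathbf{Top}}$. The forgetful functor $\mathcal{O}\text{-}\mathbf{Cat}_{\mathbf{Top}}\to\mathcal{O}\text{-}\mathbf{Graph}_{\mathbf{Top}}$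 has a left adjoint $L$ (the free topological category on a graph). Let $\mathbf{C}\to\mathbf{D}$ be a weak equivalence in $\mathcal{O}\text{-}\mathbf{Cat}_{\mathbf{Top}}$, and let $\Gamma$ be an object of $\mathcal{O}\text{-}\mathbf{Graph}_{\mathbf{Top}}$. Then the free products $L(\Gamma)\star\mathbf{C}$ and $L(\Gamma)\star\mathbf{D}$ exist, and the induced morphism $$L(\Gamma)\star\mathbf{C}\longrightarrow L(\Gamma)\star\mathbf{D}$$ is a weak equivalence in $\mathcal{O}\text{-}\mathbf{Cat}_{\mathbf{Top}}$. -/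

import Mathlib

open CategoryTheory CategoryTheory.Limits Topology

universe u v w

/-! ### Compactly generated weakly Hausdorff spaces -/

/-- A space is weakly Hausdorff if every continuous image of a compact Hausdorff space in it
is closed. -/
class WeaklyHausdorffSpace (X : Type u) [TopologicalSpace X] : Prop where
  isClosed_range : ∀ (K : CompHaus.{u}) (f : C(K, X)), IsClosed (Set.range f)

/-- A map out of the product `X × Y`, formed in compactly generated spaces (i.e. the set `X × Y`
with the compactly generated topology associated with the product topology), is continuous. -/
def KContinuous {X Y Z : Type u} [TopologicalSpace X] [TopologicalSpace Y] [TopologicalSpace Z]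
    (f : X × Y → Z) : Prop :=
  Continuous[TopologicalSpace.compactlyGenerated.{u} (X × Y), inferInstance] f

lemma KContinuous.comp_compHaus {X Y Z : Type u} [TopologicalSpace X] [TopologicalSpace Y]
    [TopologicalSpace Z] {f : X × Y → Z} (hf : KContinuous f) (K : CompHaus.{u})
    (g : C(K, X × Y)) : Continuous (f ∘ g) := by
  unfold KContinuous TopologicalSpace.compactlyGenerated at hf
  rw [continuous_coinduced_dom] at hf
  exact (continuous_sigma_iff.1 hf) ⟨K, g⟩

lemma KContinuous.joined {X Y Z : Type u} [TopologicalSpace X] [TopologicalSpace Y]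
    [TopologicalSpace Z] {f : X × Y → Z} (hf : KContinuous f) {x x' : X} {y y' : Y}
    (hx : Joined x x') (hy : Joined y y') : Joined (f (x, y)) (f (x', y')) := by
  obtain ⟨p⟩ := hx
  obtain ⟨q⟩ := hy
  have h := hf.comp_compHaus (CompHaus.of (ULift.{u} unitInterval))
    ⟨fun t => (p t.down, q t.down),
      (p.continuous.comp continuous_uliftDown).prodMk (q.continuous.comp continuous_uliftDown)⟩
  exact ⟨{ toFun := fun t => f (p t, q t)
           continuous_toFun := h.comp continuous_uliftUp
           source' := by simp
           target' := by simp }⟩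

/-! ### Weak homotopy equivalences -/

/-- The map induced on sets of path components by a continuous map. -/
def pathComponentsMap {X : Type v} {Y : Type w} [TopologicalSpace X] [TopologicalSpace Y]
    (f : C(X, Y)) : ZerothHomotopy X → ZerothHomotopy Y :=
  Quotient.map f (fun _ _ h => ⟨h.some.map f.continuous⟩)

/-- The map `π_n(X, x) → π_n(Y, f x)` induced by a continuous map `f`. -/
def homotopyGroupMap {X : Type v} {Y : Type w} [TopologicalSpace X] [TopologicalSpace Y]
    (f : C(X, Y)) (n : ℕ) (x : X) :
    HomotopyGroup.Pi n X x → HomotopyGroup.Pi n Y (f x) :=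
  Quotient.map
    (fun p => (⟨f.comp p.1, fun y hy => congrArg f (p.2 y hy)⟩ : GenLoop (Fin n) Y (f x)))
    (fun _ _ h => ContinuousMap.HomotopicRel.comp_continuousMap h f)

/-- A weak homotopy equivalence: a continuous map that is bijective on path components and on all
homotopy groups at all base points. -/
structure IsWeakHomotopyEquiv {X : Type v} {Y : Type w} [TopologicalSpace X] [TopologicalSpace Y]
    (f : C(X, Y)) : Prop where
  bijective_pathComponents : Function.Bijective (pathComponentsMap f)
  bijective_homotopyGroup : ∀ (n : ℕ), 1 ≤ n → ∀ x : X,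
    Function.Bijective (homotopyGroupMap f n x)

/-! ### Topological graphs and topological categories with a fixed set of objects -/

/-- A graph enriched in compactly generated weakly Hausdorff spaces, with set of vertices `O`. -/
structure TopGraph (O : Type u) where
  /-- The space of edges from `a` to `b`. -/
  Map : O → O → Type u
  [top : ∀ a b, TopologicalSpace (Map a b)]
  [cg : ∀ a b, CompactlyGeneratedSpace (Map a b)]
  [wh : ∀ a b, WeaklyHausdorffSpace (Map a b)]

attribute [instance] TopGraph.top TopGraph.cg TopGraph.wh

/-- A morphism of graphs that is the identity on vertices. -/
@[ext]
structure TopGraph.Hom {O : Type u} (Γ Δ : TopGraph O) where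
  map : ∀ a b, C(Γ.Map a b, Δ.Map a b)

instance {O : Type u} : Category.{u} (TopGraph O) where
  Hom := TopGraph.Hom
  id Γ := ⟨fun _ _ => ContinuousMap.id _⟩
  comp f g := ⟨fun a b => (g.map a b).comp (f.map a b)⟩

/-- A category enriched in compactly generated weakly Hausdorff spaces (with their cartesian
product), with set of objects `O`. Composition is written in diagrammatic order. -/
structure TopCategory (O : Type u) extends TopGraph O where
  one : ∀ a, Map a a
  comp : ∀ {a b c}, Map a b → Map b c → Map a c
  one_comp : ∀ {a b} (f : Map a b), comp (one a) f = f
  comp_one : ∀ {a b} (f : Map a b), comp f (one b) = f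
  assoc : ∀ {a b c d} (f : Map a b) (g : Map b c) (h : Map c d),
    comp (comp f g) h = comp f (comp g h)
  continuous_comp : ∀ a b c, KContinuous (fun p : Map a b × Map b c => comp p.1 p.2)

/-- An enriched functor that is the identity on objects. -/
@[ext]
structure TopCategory.Hom {O : Type u} (C D : TopCategory O) extends
    TopGraph.Hom C.toTopGraph D.toTopGraph where
  map_one : ∀ a, map a a (C.one a) = D.one a
  map_comp : ∀ {a b c} (f : C.Map a b) (g : C.Map b c),
    map a c (C.comp f g) = D.comp (map a b f) (map b c g)

instance {O : Type u} : Category.{u} (TopCategory O) where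
  Hom := TopCategory.Hom
  id C :=
    { map := fun _ _ => ContinuousMap.id _
      map_one := fun _ => rfl
      map_comp := fun _ _ => rfl }
  comp F G :=
    { map := fun a b => (G.map a b).comp (F.map a b)
      map_one := fun a => by simp [F.map_one, G.map_one]
      map_comp := fun f g => by simp [F.map_comp, G.map_comp] }

/-- The forgetful functor from topological categories to topological graphs. -/
def TopCategory.forget (O : Type u) : TopCategory O ⥤ TopGraph O where
  obj C := C.toTopGraph
  map F := F.toHom

/-- The continuous map on mapping spaces given by a morphism of topological categories. -/
def TopCategory.mapOn {O : Type u} {C D : TopCategory O} (F : C ⟶ D) (a b : O) :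
    C(C.Map a b, D.Map a b) :=
  (TopCategory.Hom.toHom F).map a b

/-! ### Weak equivalences of topological categories -/

/-- The objects of the category `π₀ C`. -/
@[ext]
structure TopCategory.PiZero {O : Type u} (C : TopCategory O) where
  of ::
  obj : O

/-- The ordinary category `π₀ C`: its morphisms are the path components of the mapping spaces. -/
instance {O : Type u} (C : TopCategory O) : Category.{u} C.PiZero where
  Hom a b := ZerothHomotopy (C.Map a.obj b.obj)
  id a := ZerothHomotopy.mk (C.one a.obj)
  comp {a b c} f g := Quotient.map₂ (fun x y => C.comp x y)
    (fun _ _ hx _ _ hy => (C.continuous_comp a.obj b.obj c.obj).joined hx hy) f g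
  id_comp := by
    rintro a b ⟨f⟩
    exact congrArg ZerothHomotopy.mk (C.one_comp f)
  comp_id := by
    rintro a b ⟨f⟩
    exact congrArg ZerothHomotopy.mk (C.comp_one f)
  assoc := by
    rintro a b c d ⟨f⟩ ⟨g⟩ ⟨h⟩
    exact congrArg ZerothHomotopy.mk (C.assoc f g h)

/-- The functor `π₀ C ⥤ π₀ D` induced by a morphism `C ⟶ D`. -/
def TopCategory.piZeroMap {O : Type u} {C D : TopCategory O} (F : C ⟶ D) :
    C.PiZero ⥤ D.PiZero where
  obj a := ⟨a.obj⟩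
  map {a b} f := pathComponentsMap (TopCategory.mapOn F a.obj b.obj) f
  map_id a := congrArg ZerothHomotopy.mk (TopCategory.Hom.map_one F a.obj)
  map_comp := by
    rintro a b c ⟨f⟩ ⟨g⟩
    exact congrArg ZerothHomotopy.mk (TopCategory.Hom.map_comp F f g)

/-- A weak equivalence of topological categories: a weak homotopy equivalence on all mapping
spaces, and an equivalence of categories on `π₀`. -/
structure TopCategory.IsWeakEquiv {O : Type u} {C D : TopCategory O} (F : C ⟶ D) : Prop where
  map : ∀ a b, IsWeakHomotopyEquiv (TopCategory.mapOn F a b)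
  piZero : (TopCategory.piZeroMap F).IsEquivalence

/-! The free product of `L(Γ)` and `C` has an explicit model, `wordCategory`. A morphism is a word
c₀ γ₁ c₁ ⋯ γₙ cₙ alternating between `C` and `Γ`, with no relations left to impose. The space of
words is therefore a disjoint union, over the endpoints of the γᵢ, of finite products of mapping
spaces of `C` and edge spaces of `Γ`. A functor C → D keeps the shape and acts factor by factor, by
itself or by the identity. Weak homotopy equivalences are stable under finite products
(`IsWeakHomotopyEquiv.prodMap`) and disjoint unions (`IsWeakHomotopyEquiv.sigmaCongr`), so the map
on words is one. The condition on π₀ is then automatic, the objects being fixed.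

The topology is handled by testing on compact Hausdorff spaces. Words carry the ordinary product
topology, and `Kification` is applied once, at the end. Concatenation and evaluation need only be
`TestContinuous`, and passing to `Kification` is a weak equivalence since cubes are compact
Hausdorff. Weak Hausdorffness is carried by `ClosedTestEqualizers`, which passes to products, sums
and finer topologies.

Evaluating words gives the universal property (`isColimitWordCofan`); over the discrete category it
also gives the left adjoint `L`. Uniqueness of colimits transfers the result to any coproducts. -/

/-! ### Maps that are continuous on compact Hausdorff test spaces -/

/-- A map whose composites with all continuous maps from compact Hausdorff spaces are continuous. -/
def TestContinuous {X Y : Type u} [TopologicalSpace X] [TopologicalSpace Y] (f : X → Y) : Prop :=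
  ∀ (K : Type u) [TopologicalSpace K] [CompactSpace K] [T2Space K] (g : K → X),
    Continuous g → Continuous (fun k => f (g k))

namespace TestContinuous

variable {X Y Z : Type u} [TopologicalSpace X] [TopologicalSpace Y] [TopologicalSpace Z]

lemma _root_.Continuous.testContinuous {f : X → Y} (hf : Continuous f) : TestContinuous f :=
  fun _ _ _ _ _ hg => hf.comp hg

lemma comp {g : Y → Z} {f : X → Y} (hg : TestContinuous g) (hf : TestContinuous f) :
    TestContinuous (fun x => g (f x)) :=
  fun K _ _ _ h hh => hg K _ (hf K h hh)

lemma prodMk {f : X → Y} {g : X → Z} (hf : TestContinuous f) (hg : TestContinuous g) :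
    TestContinuous (fun x => (f x, g x)) :=
  fun K _ _ _ h hh => (hf K h hh).prodMk (hg K h hh)

lemma continuous [CompactlyGeneratedSpace X] {f : X → Y} (hf : TestContinuous f) :
    Continuous f :=
  continuous_from_compactlyGeneratedSpace f fun K _ _ _ g hg => hf K g hg

/-- Cubes live in `Type` while test spaces live in `Type u`; `ULift` bridges the two. -/
lemma comp_small {f : X → Y} (hf : TestContinuous f) {K : Type} [TopologicalSpace K]
    [CompactSpace K] [T2Space K] {g : K → X} (hg : Continuous g) :
    Continuous (fun k => f (g k)) :=
  (hf (ULift.{u} K) _ (hg.comp continuous_uliftDown)).comp continuous_uliftUp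

/-- The preimage of a summand in a test space is clopen, hence itself a test space, and continuity
can be checked locally on it. -/
lemma sigma {ι : Type u} {A : ι → Type u} [∀ i, TopologicalSpace (A i)] {f : (Σ i, A i) → Y}
    (hf : ∀ i, TestContinuous fun x : A i => f ⟨i, x⟩) : TestContinuous f := by
  intro K _ _ _ g hg
  rw [continuous_iff_continuousAt]
  intro k
  let S : Set K := g ⁻¹' Set.range (Sigma.mk (g k).1)
  have hS : IsClopen S := isClopen_range_sigmaMk.preimage hg
  have : CompactSpace S := isCompact_iff_compactSpace.1 hS.isClosed.isCompact
  choose h hh using fun s : S => s.2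
  have hc : Continuous h := by
    rw [(IsOpenEmbedding.sigmaMk (σ := A) (i := (g k).1)).isEmbedding.continuous_iff]
    exact (hg.comp continuous_subtype_val).congr fun s => (hh s).symm
  have h2 : Continuous (fun s : S => f (g s)) :=
    (hf _ S h hc).congr fun s => congrArg f (hh s)
  exact (continuousOn_iff_continuous_domRestrict.2 h2).continuousAt
    (hS.isOpen.mem_nhds ⟨(g k).2, rfl⟩)

/-- Binary products distribute over disjoint unions up to homeomorphism, so `sigma` applies in each
variable in turn. -/
lemma sigma_prod {ι κ : Type u} {A : ι → Type u} {B : κ → Type u} [∀ i, TopologicalSpace (A i)]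
    [∀ i, TopologicalSpace (B i)] {f : (Σ i, A i) × (Σ i, B i) → Y}
    (hf : ∀ i j, TestContinuous fun p : A i × B j => f (⟨i, p.1⟩, ⟨j, p.2⟩)) :
    TestContinuous f := by
  have h1 : ∀ i, TestContinuous fun p : A i × (Σ j, B j) => f (⟨i, p.1⟩, p.2) := by
    intro i
    have h2 : TestContinuous fun p : (Σ j, A i × B j) => f (⟨i, p.2.1⟩, ⟨p.1, p.2.2⟩) :=
      sigma fun j => hf i j
    have h3 : Continuous fun p : A i × (Σ j, B j) => (⟨p.2.1, p.1, p.2.2⟩ : Σ j, A i × B j) :=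
      have h4 : Continuous fun p : (Σ j, B j × A i) => (⟨p.1, p.2.2, p.2.1⟩ : Σ j, A i × B j) :=
        continuous_sigma fun j => (continuous_sigmaMk (σ := fun j => A i × B j) (i := j)).comp
          (continuous_snd.prodMk continuous_fst)
      (h4.comp (Homeomorph.sigmaProdDistrib (X := B) (Y := A i)).continuous).comp continuous_swap
    exact h2.comp h3.testContinuous
  have h2 : TestContinuous fun p : (Σ i, A i × (Σ j, B j)) => f (⟨p.1, p.2.1⟩, p.2.2) :=
    sigma h1
  exact h2.comp (Homeomorph.sigmaProdDistrib (X := A) (Y := Σ j, B j)).continuous.testContinuous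

end TestContinuous

lemma kContinuous_iff {X Y Z : Type u} [TopologicalSpace X] [TopologicalSpace Y]
    [TopologicalSpace Z] {f : X × Y → Z} : KContinuous f ↔ TestContinuous f :=
  ⟨fun h K _ _ _ g hg => h.comp_compHaus (CompHaus.of K) ⟨g, hg⟩,
    fun h => continuous_from_compactlyGenerated f fun S g => h S g g.continuous⟩

/-! ### The compactly generated topology -/

/-- The set `X` with the compactly generated topology associated with the topology of `X`. -/
def Kification (X : Type u) : Type u := X

namespace Kification

/-- The identity, as a map from `Kification X` to `X`. -/
def toBase {X : Type u} : Kification X → X := fun x => x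

/-- The identity, as a map from `X` to `Kification X`. -/
def ofBase {X : Type u} : X → Kification X := fun x => x

variable {X Y : Type u} [TopologicalSpace X] [TopologicalSpace Y]

instance : TopologicalSpace (Kification X) := TopologicalSpace.compactlyGenerated.{u} X

lemma continuous_toBase : Continuous (toBase : Kification X → X) :=
  continuous_from_compactlyGenerated (X := X) _ fun _ g => g.continuous

/-- Each test map into `X` indexes one summand of the space from which the topology of `Kification
X` is coinduced. -/
lemma testContinuous_ofBase : TestContinuous (ofBase : X → Kification X) := by
  intro K _ _ _ g hg
  have h : Continuous (Y := Kification X)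
      (fun ⟨⟨_, i⟩, s⟩ => i s : (Σ (i : (S : CompHaus.{u}) × C(S, X)), i.fst) → X) :=
    continuous_coinduced_rng
  exact h.comp (continuous_sigmaMk (σ := fun i : (S : CompHaus.{u}) × C(S, X) => i.fst)
    (i := ⟨CompHaus.of K, ⟨g, hg⟩⟩))

instance : CompactlyGeneratedSpace (Kification X) :=
  uCompactlyGeneratedSpace_of_continuous_maps fun f h =>
    continuous_from_compactlyGenerated (X := X) f fun S g =>
      h S ⟨fun k => ofBase (g k), testContinuous_ofBase S g g.continuous⟩

lemma continuous_of {f : Kification X → Y} (hf : TestContinuous fun x : X => f (ofBase x)) :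
    Continuous f :=
  (hf.comp continuous_toBase.testContinuous).continuous

end Kification

/-! ### Weakly Hausdorff spaces -/

/-- The equalizer of any two continuous maps from a compact Hausdorff space is closed. -/
def ClosedTestEqualizers (X : Type u) [TopologicalSpace X] : Prop :=
  ∀ (K : Type u) [TopologicalSpace K] [CompactSpace K] [T2Space K] (f g : K → X),
    Continuous f → Continuous g → IsClosed {k | f k = g k}

namespace ClosedTestEqualizers

variable {X Y : Type u} [TopologicalSpace X] [TopologicalSpace Y]

lemma of_injective (hY : ClosedTestEqualizers Y) {j : X → Y} (hj : Continuous j)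
    (hi : Function.Injective j) : ClosedTestEqualizers X := by
  intro K _ _ _ f g hf hg
  simpa [hi.eq_iff] using hY K _ _ (hj.comp hf) (hj.comp hg)

lemma prod (hX : ClosedTestEqualizers X) (hY : ClosedTestEqualizers Y) :
    ClosedTestEqualizers (X × Y) := by
  intro K _ _ _ f g hf hg
  convert (hX K _ _ (continuous_fst.comp hf) (continuous_fst.comp hg)).inter
    (hY K _ _ (continuous_snd.comp hf) (continuous_snd.comp hg)) using 1
  ext k
  exact Prod.ext_iff

/-- The maps differ at a point either because they land in different summands, which is an open
condition, or inside a common summand `i`; there the hypothesis on `A i` applies over a clopen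
subset of `K`. -/
lemma sigma {ι : Type u} {A : ι → Type u} [∀ i, TopologicalSpace (A i)]
    (hA : ∀ i, ClosedTestEqualizers (A i)) : ClosedTestEqualizers (Σ i, A i) := by
  intro K _ _ _ f g hf hg
  have key : ∀ i, IsOpen {k | f k ∈ Set.range (Sigma.mk i) ∧ f k ≠ g k} := by
    intro i
    let S : Set K := f ⁻¹' Set.range (Sigma.mk i) ∩ g ⁻¹' Set.range (Sigma.mk i)
    have hS : IsClopen S :=
      (isClopen_range_sigmaMk.preimage hf).inter (isClopen_range_sigmaMk.preimage hg)
    have : CompactSpace S := isCompact_iff_compactSpace.1 hS.isClosed.isCompact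
    choose f' hf' using fun s : S => s.2.1
    choose g' hg' using fun s : S => s.2.2
    have he := (IsOpenEmbedding.sigmaMk (σ := A) (i := i)).isEmbedding
    have hfc : Continuous f' := by
      rw [he.continuous_iff]
      exact (hf.comp continuous_subtype_val).congr fun s => (hf' s).symm
    have hgc : Continuous g' := by
      rw [he.continuous_iff]
      exact (hg.comp continuous_subtype_val).congr fun s => (hg' s).symm
    have h1 := hS.isOpen.isOpenMap_subtype_val _ (hA i S f' g' hfc hgc).isOpen_compl
    have h2 : IsOpen (f ⁻¹' Set.range (Sigma.mk i) ∩ (g ⁻¹' Set.range (Sigma.mk i))ᶜ) :=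
      (isClopen_range_sigmaMk.preimage hf).isOpen.inter
        (isClopen_range_sigmaMk.preimage hg).isClosed.isOpen_compl
    convert h1.union h2 using 1
    ext k
    constructor
    · rintro ⟨h3, h4⟩
      by_cases h5 : g k ∈ Set.range (Sigma.mk i)
      · refine Or.inl ⟨⟨k, h3, h5⟩, fun h6 => h4 ?_, rfl⟩
        rw [← hf' ⟨k, h3, h5⟩, ← hg' ⟨k, h3, h5⟩]
        exact congrArg _ h6
      · exact Or.inr ⟨h3, h5⟩
    · rintro (⟨s, h3, rfl⟩ | ⟨h3, h4⟩)
      · refine ⟨s.2.1, fun h6 => h3 ?_⟩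
        rw [← hf' s, ← hg' s] at h6
        exact sigma_mk_injective h6
      · exact ⟨h3, fun h6 => h4 (by rwa [Set.mem_preimage, ← h6])⟩
  rw [← isOpen_compl_iff]
  convert isOpen_iUnion key using 1
  ext k
  simp only [Set.mem_compl_iff, Set.mem_ofPred_eq, Set.mem_iUnion]
  exact ⟨fun h => ⟨(f k).1, ⟨(f k).2, rfl⟩, h⟩, fun ⟨_, _, h⟩ => h⟩

/-- The preimage of the range of `f` under a test map `g` is the projection, along the compact space
`K`, of the closed set where `f k = g l`. -/
lemma weaklyHausdorffSpace [CompactlyGeneratedSpace X] (hX : ClosedTestEqualizers X) :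
    WeaklyHausdorffSpace X where
  isClosed_range K f := by
    refine CompactlyGeneratedSpace.isClosed' fun L _ _ _ g hg => ?_
    have h := hX (K × L) _ _ (f.continuous.comp continuous_fst) (hg.comp continuous_snd)
    convert isClosedMap_snd_of_compactSpace _ h using 1
    ext l
    simp

end ClosedTestEqualizers

/-- If `f k ≠ g k`, the fibres of `Sum.elim f g` over these points are disjoint closed subsets of
the normal space `K ⊕ K`. Since images of closed sets are closed, separating neighbourhoods of the
fibres contain preimages of open neighbourhoods of the two points. -/
lemma WeaklyHausdorffSpace.closedTestEqualizers (X : Type u) [TopologicalSpace X]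
    [WeaklyHausdorffSpace X] : ClosedTestEqualizers X := by
  have key : ∀ (K : Type u) [TopologicalSpace K] [CompactSpace K] [T2Space K] (f : K → X),
      Continuous f → ∀ C : Set K, IsClosed C → IsClosed (f '' C) := by
    intro K _ _ _ f hf C hC
    have : CompactSpace C := isCompact_iff_compactSpace.1 hC.isCompact
    have h := isClosed_range (CompHaus.of C) ⟨fun c : C => f c, hf.comp continuous_subtype_val⟩
    convert h using 1
    ext x
    simp
  intro K _ _ _ f g hf hg
  rw [← isOpen_compl_iff, isOpen_iff_mem_nhds]
  intro k hk
  have hh : Continuous (Sum.elim f g) := hf.sumElim hg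
  have hpt : ∀ x : X, IsClosed (Sum.elim f g ⁻¹' {x}) := by
    intro x
    -- Points are closed, being images of the one-point space.
    have := key PUnit.{u + 1} (fun _ => x) continuous_const Set.univ isClosed_univ
    exact IsClosed.preimage hh (by simpa using this)
  have hd : Disjoint (Sum.elim f g ⁻¹' {f k}) (Sum.elim f g ⁻¹' {g k}) :=
    Disjoint.preimage _ (Set.disjoint_singleton.2 hk)
  obtain ⟨U, V, hU, hV, hfU, hgV, hUV⟩ := normal_separation (hpt (f k)) (hpt (g k)) hd
  have hU' := (key _ _ hh _ hU.isClosed_compl).isOpen_compl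
  have hV' := (key _ _ hh _ hV.isClosed_compl).isOpen_compl
  have h1 : f k ∈ (Sum.elim f g '' Uᶜ)ᶜ := fun ⟨s, hs, he⟩ => hs (hfU he)
  have h2 : g k ∈ (Sum.elim f g '' Vᶜ)ᶜ := fun ⟨s, hs, he⟩ => hs (hgV he)
  filter_upwards [(hU'.preimage hf).mem_nhds h1, (hV'.preimage hg).mem_nhds h2] with l hl1 hl2 he
  have h3 : Sum.inl l ∈ U := by
    by_contra h; exact hl1 ⟨_, h, rfl⟩
  have h4 : Sum.inl l ∈ V := by
    by_contra h; exact hl2 ⟨_, h, he⟩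
  exact Set.disjoint_left.1 hUV h3 h4

lemma Kification.closedTestEqualizers {X : Type u} [TopologicalSpace X]
    (h : ClosedTestEqualizers X) : ClosedTestEqualizers (Kification X) :=
  h.of_injective Kification.continuous_toBase fun _ _ h => h

/-! ### Weak homotopy equivalences -/

section

variable {X : Type u} {Y : Type v} {Z : Type w} [TopologicalSpace X] [TopologicalSpace Y]
  [TopologicalSpace Z]

/-- Replaces classes by representatives, so that later proofs can manipulate actual paths, cubes and
homotopies. -/
lemma isWeakHomotopyEquiv_iff {f : C(X, Y)} : IsWeakHomotopyEquiv f ↔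
    ((∀ x x', Joined (f x) (f x') → Joined x x') ∧ ∀ y, ∃ x, Joined (f x) y) ∧
    ∀ (n : ℕ), 1 ≤ n → ∀ x : X,
      (∀ p q : GenLoop (Fin n) X x,
        (f.comp p.1).HomotopicRel (f.comp q.1) (Cube.boundary (Fin n)) →
          p.1.HomotopicRel q.1 (Cube.boundary (Fin n))) ∧
      ∀ p : GenLoop (Fin n) Y (f x), ∃ q : GenLoop (Fin n) X x,
        (f.comp q.1).HomotopicRel p.1 (Cube.boundary (Fin n)) := by
  constructor
  · intro h
    refine ⟨⟨fun x x' hx => ?_, fun y => ?_⟩, fun n hn x => ⟨fun p q hpq => ?_, fun p => ?_⟩⟩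
    · exact Quotient.exact (h.1.1 (a₁ := ZerothHomotopy.mk x) (a₂ := ZerothHomotopy.mk x')
        (Quotient.sound hx))
    · obtain ⟨⟨x⟩, hx⟩ := h.1.2 (ZerothHomotopy.mk y)
      exact ⟨x, Quotient.exact hx⟩
    · exact Quotient.exact ((h.2 n hn x).1 (a₁ := Quotient.mk _ p) (a₂ := Quotient.mk _ q)
        (Quotient.sound hpq))
    · obtain ⟨⟨q⟩, hq⟩ := (h.2 n hn x).2 (Quotient.mk _ p)
      exact ⟨q, Quotient.exact hq⟩
  · rintro ⟨⟨h1, h2⟩, h3⟩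
    refine ⟨⟨?_, ?_⟩, fun n hn x => ⟨?_, ?_⟩⟩
    · rintro ⟨x⟩ ⟨x'⟩ h
      exact Quotient.sound (h1 x x' (Quotient.exact h))
    · rintro ⟨y⟩
      obtain ⟨x, hx⟩ := h2 y
      exact ⟨ZerothHomotopy.mk x, Quotient.sound hx⟩
    · rintro ⟨p⟩ ⟨q⟩ h
      exact Quotient.sound ((h3 n hn x).1 p q (Quotient.exact h))
    · rintro ⟨p⟩
      obtain ⟨q, hq⟩ := (h3 n hn x).2 p
      exact ⟨Quotient.mk _ q, Quotient.sound hq⟩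

lemma pathComponentsMap_comp (g : C(Y, Z)) (f : C(X, Y)) :
    pathComponentsMap (g.comp f) = pathComponentsMap g ∘ pathComponentsMap f := by
  ext ⟨x⟩
  rfl

lemma homotopyGroupMap_comp (g : C(Y, Z)) (f : C(X, Y)) (n : ℕ) (x : X) :
    homotopyGroupMap (g.comp f) n x = homotopyGroupMap g n (f x) ∘ homotopyGroupMap f n x := by
  ext ⟨x⟩
  rfl

namespace IsWeakHomotopyEquiv

lemma comp {g : C(Y, Z)} {f : C(X, Y)} (hg : IsWeakHomotopyEquiv g)
    (hf : IsWeakHomotopyEquiv f) : IsWeakHomotopyEquiv (g.comp f) where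
  bijective_pathComponents := by
    rw [pathComponentsMap_comp]
    exact hg.1.comp hf.1
  bijective_homotopyGroup n hn x := by
    rw [homotopyGroupMap_comp]
    exact (hg.2 n hn _).comp (hf.2 n hn x)

/-- This case of two-out-of-three needs no change of base point: `g` is used only at base points `f
x`. -/
lemma of_comp_left {g : C(Y, Z)} {f : C(X, Y)} (hg : IsWeakHomotopyEquiv g)
    (h : IsWeakHomotopyEquiv (g.comp f)) : IsWeakHomotopyEquiv f where
  bijective_pathComponents := by
    have := h.1
    rw [pathComponentsMap_comp] at this
    exact (Function.Bijective.of_comp_iff' hg.1 _).1 this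
  bijective_homotopyGroup n hn x := by
    have := h.2 n hn x
    rw [homotopyGroupMap_comp] at this
    exact (Function.Bijective.of_comp_iff' (hg.2 n hn _) _).1 this

/-- A continuous bijection along which maps from compact Hausdorff spaces lift continuously is a
weak homotopy equivalence. -/
lemma of_lift {f : C(X, Y)} (s : Y → X) (hfs : ∀ y, f (s y) = y) (hsf : ∀ x, s (f x) = x)
    (hs : ∀ (K : Type) [TopologicalSpace K] [CompactSpace K] [T2Space K] (g : K → Y),
      Continuous g → Continuous (fun k => s (g k))) : IsWeakHomotopyEquiv f := by
  rw [isWeakHomotopyEquiv_iff]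
  refine ⟨⟨fun x x' ⟨p⟩ => ?_, fun y => ⟨s y, by rw [hfs]⟩⟩, fun n _ x =>
    ⟨fun p q ⟨H⟩ => ⟨⟨⟨⟨fun t => s (H t), hs _ _ H.continuous⟩, ?_, ?_⟩, ?_⟩⟩, fun p => ?_⟩⟩
  · exact ⟨⟨⟨fun t => s (p t), hs _ _ p.continuous⟩, by simp [hsf], by simp [hsf]⟩⟩
  · intro y
    simp [hsf]
  · intro y
    simp [hsf]
  · intro t y hy
    change s (H (t, y)) = p.1 y
    rw [H.eq_fst t hy]
    exact hsf _
  · refine ⟨⟨⟨fun t => s (p.1 t), hs _ _ p.1.continuous⟩, fun y hy => ?_⟩, ?_⟩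
    · change s (p.1 y) = x
      rw [p.2 y hy, hsf]
    · convert ContinuousMap.HomotopicRel.refl p.1 using 1
      ext y
      exact hfs _

lemma of_homeomorph (e : X ≃ₜ Y) : IsWeakHomotopyEquiv (e : C(X, Y)) :=
  of_lift e.symm e.apply_symm_apply e.symm_apply_apply
    fun _ _ _ _ _ hg => e.symm.continuous.comp hg

protected lemma id : IsWeakHomotopyEquiv (ContinuousMap.id X) :=
  of_homeomorph (Homeomorph.refl X)

end IsWeakHomotopyEquiv

end

/-- Paths, loops and homotopies in a product are pairs of such, so each lifting problem splits into
its two coordinates. -/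
lemma IsWeakHomotopyEquiv.prodMap {X X' : Type u} {Y Y' : Type v} [TopologicalSpace X]
    [TopologicalSpace Y] [TopologicalSpace X'] [TopologicalSpace Y'] {f : C(X, X')} {g : C(Y, Y')}
    (hf : IsWeakHomotopyEquiv f) (hg : IsWeakHomotopyEquiv g) :
    IsWeakHomotopyEquiv (f.prodMap g) := by
  rw [isWeakHomotopyEquiv_iff] at *
  obtain ⟨⟨f1, f2⟩, f3⟩ := hf
  obtain ⟨⟨g1, g2⟩, g3⟩ := hg
  refine ⟨⟨?_, ?_⟩, ?_⟩
  · rintro ⟨x, y⟩ ⟨x', y'⟩ ⟨p⟩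
    obtain ⟨q⟩ := f1 x x' ⟨p.map continuous_fst⟩
    obtain ⟨r⟩ := g1 y y' ⟨p.map continuous_snd⟩
    exact ⟨q.prod r⟩
  · rintro ⟨x, y⟩
    obtain ⟨x', ⟨p⟩⟩ := f2 x
    obtain ⟨y', ⟨q⟩⟩ := g2 y
    exact ⟨(x', y'), ⟨p.prod q⟩⟩
  · rintro n hn ⟨x, y⟩
    refine ⟨fun p q h => ?_, fun p => ?_⟩
    · let p1 : GenLoop (Fin n) X x :=
        ⟨.comp .fst p.1, fun y hy => congrArg Prod.fst (p.2 y hy)⟩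
      let p2 : GenLoop (Fin n) Y y :=
        ⟨.comp .snd p.1, fun y hy => congrArg Prod.snd (p.2 y hy)⟩
      let q1 : GenLoop (Fin n) X x :=
        ⟨.comp .fst q.1, fun y hy => congrArg Prod.fst (q.2 y hy)⟩
      let q2 : GenLoop (Fin n) Y y :=
        ⟨.comp .snd q.1, fun y hy => congrArg Prod.snd (q.2 y hy)⟩
      obtain ⟨H1⟩ := (f3 n hn x).1 p1 q1 (h.comp_continuousMap .fst)
      obtain ⟨H2⟩ := (g3 n hn y).1 p2 q2 (h.comp_continuousMap .snd)
      exact ⟨H1.prod H2⟩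
    · obtain ⟨q1, ⟨H1⟩⟩ := (f3 n hn x).2
        ⟨.comp .fst p.1, fun y hy => congrArg Prod.fst (p.2 y hy)⟩
      obtain ⟨q2, ⟨H2⟩⟩ := (g3 n hn y).2
        ⟨.comp .snd p.1, fun y hy => congrArg Prod.snd (p.2 y hy)⟩
      exact ⟨⟨q1.1.prodMk q2.1, fun y hy => Prod.ext (q1.2 y hy) (q2.2 y hy)⟩, ⟨H1.prod H2⟩⟩

section Sigma

variable {ι : Type w} {A : ι → Type u} [∀ i, TopologicalSpace (A i)]

lemma Continuous.exists_lift_sigmaMk {T : Type*} [TopologicalSpace T] [ConnectedSpace T]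
    {g : T → Σ i, A i} (hg : Continuous g) {i : ι} {t : T} {x : A i} (ht : g t = ⟨i, x⟩) :
    ∃ h : C(T, A i), ∀ t, g t = ⟨i, h t⟩ := by
  obtain ⟨j, h, hc, rfl⟩ := hg.exists_lift_sigma
  obtain rfl : j = i := congrArg Sigma.fst ht
  exact ⟨⟨h, hc⟩, fun _ => rfl⟩

lemma GenLoop.exists_lift_sigmaMk {n : ℕ} (hn : 1 ≤ n) {i : ι} {x : A i}
    (p : GenLoop (Fin n) (Σ i, A i) ⟨i, x⟩) :
    ∃ q : GenLoop (Fin n) (A i) x, p.1 = (ContinuousMap.sigmaMk i).comp q.1 := by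
  -- As `n ≥ 1`, the boundary of the cube is nonempty, and its image fixes the summand.
  have h0 : (0 : Fin n → unitInterval) ∈ Cube.boundary (Fin n) := ⟨⟨0, hn⟩, Or.inl rfl⟩
  obtain ⟨q, hq⟩ := p.1.continuous.exists_lift_sigmaMk (p.2 _ h0)
  exact ⟨⟨q, fun y hy => sigma_mk_injective ((hq y).symm.trans (p.2 y hy))⟩,
    ContinuousMap.ext hq⟩

/-- The domain of the homotopy is connected, so the homotopy stays in one summand. -/
lemma ContinuousMap.HomotopicRel.of_sigmaMk {T : Type*} [TopologicalSpace T] [ConnectedSpace T]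
    {i : ι} {f g : C(T, A i)} {S : Set T}
    (h : ((sigmaMk i).comp f).HomotopicRel ((sigmaMk i).comp g) S) : f.HomotopicRel g S := by
  obtain ⟨H⟩ := h
  obtain ⟨t⟩ := (inferInstance : Nonempty T)
  obtain ⟨G, hG⟩ := H.continuous.exists_lift_sigmaMk (H.apply_zero t)
  refine ⟨⟨⟨G, fun x => ?_, fun x => ?_⟩, fun s x hx => ?_⟩⟩
  · exact sigma_mk_injective ((hG _).symm.trans (H.apply_zero x))
  · exact sigma_mk_injective ((hG _).symm.trans (H.apply_one x))
  · exact sigma_mk_injective ((hG _).symm.trans (H.eq_fst s hx))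

variable {B : ι → Type v} [∀ i, TopologicalSpace (B i)]

/-- The map of disjoint unions given by a family of continuous maps. -/
def ContinuousMap.sigmaCongr (f : ∀ i, C(A i, B i)) : C(Σ i, A i, Σ i, B i) :=
  ⟨fun x => ⟨x.1, f x.1 x.2⟩,
    continuous_sigma fun i => continuous_sigmaMk.comp (f i).continuous⟩

/-- Every path, loop and homotopy involved has connected domain, so the question reduces to a single
summand. -/
lemma IsWeakHomotopyEquiv.sigmaCongr {f : ∀ i, C(A i, B i)}
    (hf : ∀ i, IsWeakHomotopyEquiv (f i)) :
    IsWeakHomotopyEquiv (ContinuousMap.sigmaCongr f) := by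
  simp only [isWeakHomotopyEquiv_iff] at *
  refine ⟨⟨?_, ?_⟩, ?_⟩
  · rintro ⟨i, x⟩ ⟨j, x'⟩ ⟨p⟩
    obtain ⟨q, hq⟩ := p.continuous.exists_lift_sigmaMk p.source
    have h1 := (hq 1).symm.trans p.target
    obtain rfl : i = j := congrArg Sigma.fst h1
    obtain ⟨r⟩ := (hf i).1.1 x x' ⟨⟨q, sigma_mk_injective ((hq 0).symm.trans p.source),
      sigma_mk_injective h1⟩⟩
    exact ⟨r.map continuous_sigmaMk⟩
  · rintro ⟨i, y⟩
    obtain ⟨x, ⟨p⟩⟩ := (hf i).1.2 y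
    exact ⟨⟨i, x⟩, ⟨p.map continuous_sigmaMk⟩⟩
  · rintro n hn ⟨i, x⟩
    refine ⟨fun p q h => ?_, fun p => ?_⟩
    · obtain ⟨p', hp⟩ := GenLoop.exists_lift_sigmaMk hn p
      obtain ⟨q', hq⟩ := GenLoop.exists_lift_sigmaMk hn q
      rw [hp, hq] at h ⊢
      exact (((hf i).2 n hn x).1 p' q' (.of_sigmaMk h)).comp_continuousMap _
    · obtain ⟨p', hp⟩ := GenLoop.exists_lift_sigmaMk hn (x := f i x) p
      obtain ⟨q, hq⟩ := ((hf i).2 n hn x).2 p'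
      refine ⟨⟨(ContinuousMap.sigmaMk i).comp q.1, fun y hy => ?_⟩, ?_⟩
      · exact congrArg (Sigma.mk i) (q.2 y hy)
      · rw [hp]
        exact hq.comp_continuousMap (ContinuousMap.sigmaMk i)

end Sigma

/-! ### Words in a topological graph and a topological category -/

namespace TopCategory

variable {O : Type u}

lemma hom_ext {C D : TopCategory O} {F G : C ⟶ D}
    (h : ∀ a b x, mapOn F a b x = mapOn G a b x) : F = G := by
  refine Hom.ext ?_
  funext a b
  exact ContinuousMap.ext (h a b)

lemma mapOn_one {C D : TopCategory O} (F : C ⟶ D) (a : O) :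
    mapOn F a a (C.one a) = D.one a :=
  Hom.map_one F a

lemma mapOn_comp {C D : TopCategory O} (F : C ⟶ D) {a b c : O} (f : C.Map a b) (g : C.Map b c) :
    mapOn F a c (C.comp f g) = D.comp (mapOn F a b f) (mapOn F b c g) :=
  Hom.map_comp F f g

/-- The continuous map on spaces of edges given by a morphism of graphs. -/
def edgeMap {Γ : TopGraph O} {D : TopCategory O} (ψ : Γ ⟶ (forget O).obj D) (a b : O) :
    C(Γ.Map a b, D.Map a b) :=
  TopGraph.Hom.map ψ a b

lemma testContinuous_comp (C : TopCategory O) (a b c : O) :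
    TestContinuous fun p : C.Map a b × C.Map b c => C.comp p.1 p.2 :=
  kContinuous_iff.1 (C.continuous_comp a b c)

/-- Words from `a` to `b` whose letters in `Γ` have the prescribed endpoints. -/
def WordOfShape (Γ : TopGraph O) (C : TopCategory O) : List (O × O) → O → O → Type u
  | [], a, b => C.Map a b
  | p :: s, a, b => C.Map a p.1 × Γ.Map p.1 p.2 × WordOfShape Γ C s p.2 b

variable {Γ : TopGraph O} {C : TopCategory O}

namespace WordOfShape

instance instTop : ∀ (s : List (O × O)) (a b : O), TopologicalSpace (WordOfShape Γ C s a b)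
  | [], a, b => inferInstanceAs (TopologicalSpace (C.Map a b))
  | p :: s, a, b =>
    letI := instTop s p.2 b
    inferInstanceAs (TopologicalSpace (C.Map a p.1 × Γ.Map p.1 p.2 × WordOfShape Γ C s p.2 b))

lemma closedTestEqualizers : ∀ (s : List (O × O)) (a b : O),
    ClosedTestEqualizers (WordOfShape Γ C s a b)
  | [], a, b => WeaklyHausdorffSpace.closedTestEqualizers (C.Map a b)
  | p :: s, a, b => (WeaklyHausdorffSpace.closedTestEqualizers (C.Map a p.1)).prod
      ((WeaklyHausdorffSpace.closedTestEqualizers (Γ.Map p.1 p.2)).prod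
        (closedTestEqualizers s p.2 b))

/-- Multiplication of a word on the left by a morphism of `C`. -/
def lmul {a b c : O} (f : C.Map a b) : ∀ {s : List (O × O)},
    WordOfShape Γ C s b c → WordOfShape Γ C s a c
  | [], g => C.comp f g
  | _ :: _, w => (C.comp f w.1, w.2)

/-- Concatenation of words. -/
def mul {b c : O} {t : List (O × O)} : ∀ {s : List (O × O)} {a : O},
    WordOfShape Γ C s a b → WordOfShape Γ C t b c → WordOfShape Γ C (s ++ t) a c
  | [], _, f, v => lmul f v
  | _ :: _, _, w, v => (w.1, w.2.1, mul w.2.2 v)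

lemma testContinuous_lmul {a b c : O} : ∀ s : List (O × O),
    TestContinuous fun p : C.Map a b × WordOfShape Γ C s b c => lmul p.1 p.2
  | [] => C.testContinuous_comp a b c
  | q :: s => by
    have h1 : Continuous fun p : C.Map a b × WordOfShape Γ C (q :: s) b c => p.2.1 :=
      continuous_fst.comp continuous_snd
    have h2 : Continuous fun p : C.Map a b × WordOfShape Γ C (q :: s) b c => p.2.2 :=
      continuous_snd.comp continuous_snd
    exact ((C.testContinuous_comp a b q.1).comp
      (continuous_fst.prodMk h1).testContinuous).prodMk h2.testContinuous

lemma testContinuous_mul {b c : O} (t : List (O × O)) : ∀ (s : List (O × O)) (a : O),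
    TestContinuous fun p : WordOfShape Γ C s a b × WordOfShape Γ C t b c => mul p.1 p.2
  | [], _ => testContinuous_lmul t
  | q :: s, a => by
    let X := WordOfShape Γ C (q :: s) a b × WordOfShape Γ C t b c
    have h1 : Continuous fun p : X => p.1.1 := continuous_fst.comp continuous_fst
    have h2 : Continuous fun p : X => p.1.2.1 :=
      continuous_fst.comp (continuous_snd.comp continuous_fst)
    have h3 : Continuous fun p : X => p.1.2.2 :=
      continuous_snd.comp (continuous_snd.comp continuous_fst)
    exact h1.testContinuous.prodMk (h2.testContinuous.prodMk
      ((testContinuous_mul t s q.2).comp (h3.prodMk continuous_snd).testContinuous))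

/-- The product in `D` of the images of the letters of a word. -/
def eval {D : TopCategory O} (φ : C ⟶ D) (ψ : Γ ⟶ (forget O).obj D) {b : O} :
    ∀ {s : List (O × O)} {a : O}, WordOfShape Γ C s a b → D.Map a b
  | [], _, f => mapOn φ _ _ f
  | _ :: _, _, w => D.comp (mapOn φ _ _ w.1) (D.comp (edgeMap ψ _ _ w.2.1)
      (eval φ ψ w.2.2))

lemma testContinuous_eval {D : TopCategory O} (φ : C ⟶ D) (ψ : Γ ⟶ (forget O).obj D) {b : O} :
    ∀ (s : List (O × O)) (a : O),
      TestContinuous fun w : WordOfShape Γ C s a b => eval φ ψ w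
  | [], a => (mapOn φ a b).continuous.testContinuous
  | q :: s, a => by
    let X := WordOfShape Γ C (q :: s) a b
    have h1 : Continuous fun w : X => w.1 := continuous_fst
    have h2 : Continuous fun w : X => w.2.1 := continuous_fst.comp continuous_snd
    have h3 : Continuous fun w : X => w.2.2 := continuous_snd.comp continuous_snd
    have h4 := (D.testContinuous_comp q.1 q.2 b).comp
      (((edgeMap ψ q.1 q.2).continuous.comp h2).testContinuous.prodMk
        ((testContinuous_eval φ ψ s q.2).comp h3.testContinuous))
    exact (D.testContinuous_comp a q.1 b).comp
      (((mapOn φ a q.1).continuous.comp h1).testContinuous.prodMk h4)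

/-- The map on words induced by a morphism of topological categories. -/
def map {D : TopCategory O} (F : C ⟶ D) (b : O) : ∀ (s : List (O × O)) (a : O),
    C(WordOfShape Γ C s a b, WordOfShape Γ D s a b)
  | [], a => mapOn F a b
  | q :: s, a => (mapOn F a q.1).prodMap
      ((ContinuousMap.id (Γ.Map q.1 q.2)).prodMap (map F b s q.2))

lemma isWeakHomotopyEquiv_map {D : TopCategory O} {F : C ⟶ D}
    (hF : ∀ a b, IsWeakHomotopyEquiv (mapOn F a b)) (b : O) : ∀ (s : List (O × O)) (a : O),
      IsWeakHomotopyEquiv (map (Γ := Γ) F b s a)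
  | [], a => hF a b
  | q :: s, a => (hF a q.1).prodMap
      ((IsWeakHomotopyEquiv.id (X := Γ.Map q.1 q.2)).prodMap
        (isWeakHomotopyEquiv_map hF b s q.2))

end WordOfShape

/-- Words `c₀ γ₁ c₁ ⋯ γₙ cₙ` from `a` to `b`, with `cᵢ` in `C` and `γᵢ` in `Γ`. -/
def Word (Γ : TopGraph O) (C : TopCategory O) (a b : O) : Type u :=
  Σ s : List (O × O), WordOfShape Γ C s a b

namespace Word

instance (a b : O) : TopologicalSpace (Word Γ C a b) :=
  inferInstanceAs (TopologicalSpace (Σ s : List (O × O), WordOfShape Γ C s a b))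

/-- The word without letters in `Γ` given by a morphism of `C`. -/
def base {a b : O} (f : C.Map a b) : Word Γ C a b := ⟨[], f⟩

/-- The word obtained by prepending two letters. -/
def cons {a b x y : O} (f : C.Map a x) (e : Γ.Map x y) (w : Word Γ C y b) : Word Γ C a b :=
  ⟨(x, y) :: w.1, f, e, w.2⟩

lemma continuous_base (a b : O) :
    Continuous (base : C.Map a b → Word Γ C a b) :=
  continuous_sigmaMk (σ := fun s => WordOfShape Γ C s a b) (i := [])

lemma continuous_cons_base {a b x y : O} (f : C.Map a x) (g : C.Map y b) :
    Continuous fun e : Γ.Map x y => cons f e (base g) := by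
  have h : Continuous fun e : Γ.Map x y => ((f, e, g) : C.Map a x × Γ.Map x y × C.Map y b) :=
    continuous_const.prodMk (continuous_id.prodMk continuous_const)
  exact (continuous_sigmaMk (σ := fun s => WordOfShape Γ C s a b) (i := [(x, y)])).comp h

/-- The target stays fixed and the source varies as letters are removed from the left. Operations on
words compute definitionally on `base` and `cons`, so this avoids transport along equalities of
shapes. -/
lemma induction {b : O} {P : ∀ {a : O}, Word Γ C a b → Prop}
    (base : ∀ {a : O} (f : C.Map a b), P (base f))
    (cons : ∀ {a x y : O} (f : C.Map a x) (e : Γ.Map x y) (w : Word Γ C y b),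
      P w → P (cons f e w)) {a : O} (w : Word Γ C a b) : P w := by
  obtain ⟨s, w⟩ := w
  induction s generalizing a with
  | nil => exact base w
  | cons p s ih => exact cons w.1 w.2.1 ⟨s, w.2.2⟩ (ih _)

/-- Multiplication of a word on the left by a morphism of `C`. -/
def lmul {a b c : O} (f : C.Map a b) (w : Word Γ C b c) : Word Γ C a c := ⟨w.1, w.2.lmul f⟩

/-- Concatenation of words. -/
def mul {a b c : O} (w : Word Γ C a b) (v : Word Γ C b c) : Word Γ C a c :=
  ⟨w.1 ++ v.1, w.2.mul v.2⟩

@[simp] lemma lmul_base {a b c : O} (f : C.Map a b) (g : C.Map b c) :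
    lmul f (base g : Word Γ C b c) = base (C.comp f g) := rfl

@[simp] lemma lmul_cons {a b c x y : O} (f : C.Map a b) (g : C.Map b x) (e : Γ.Map x y)
    (w : Word Γ C y c) : lmul f (cons g e w) = cons (C.comp f g) e w := rfl

@[simp] lemma base_mul {a b c : O} (f : C.Map a b) (w : Word Γ C b c) :
    mul (base f) w = lmul f w := rfl

@[simp] lemma cons_mul {a b c x y : O} (g : C.Map a x) (e : Γ.Map x y)
    (w : Word Γ C y b) (v : Word Γ C b c) : mul (cons g e w) v = cons g e (mul w v) := rfl

@[simp] lemma one_lmul {a b : O} (w : Word Γ C a b) : lmul (C.one a) w = w := by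
  induction w using induction <;> simp [C.one_comp]

@[simp] lemma mul_one {a b : O} (w : Word Γ C a b) : mul w (base (C.one b)) = w := by
  induction w using induction <;> simp_all [C.comp_one]

lemma lmul_lmul {a b c d : O} (f : C.Map a b) (g : C.Map b c) (w : Word Γ C c d) :
    lmul f (lmul g w) = lmul (C.comp f g) w := by
  induction w using induction <;> simp [C.assoc]

lemma lmul_mul {a b c d : O} (f : C.Map a b) (w : Word Γ C b c) (v : Word Γ C c d) :
    mul (lmul f w) v = lmul f (mul w v) := by
  induction w using induction <;> simp [lmul_lmul]

lemma mul_assoc {a b c d : O} (w : Word Γ C a b) (v : Word Γ C b c) (x : Word Γ C c d) :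
    mul (mul w v) x = mul w (mul v x) := by
  induction w using induction <;> simp_all [lmul_mul]

/-- The map on words induced by a morphism of topological categories. -/
def map {D : TopCategory O} (F : C ⟶ D) (a b : O) : C(Word Γ C a b, Word Γ D a b) :=
  ContinuousMap.sigmaCongr fun s => WordOfShape.map F b s a

@[simp] lemma map_base {D : TopCategory O} (F : C ⟶ D) {a b : O} (f : C.Map a b) :
    map F a b (base f : Word Γ C a b) = base (mapOn F a b f) := rfl

@[simp] lemma map_cons {D : TopCategory O} (F : C ⟶ D) {a b x y : O} (f : C.Map a x)
    (e : Γ.Map x y) (w : Word Γ C y b) :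
    map F a b (cons f e w) = cons (mapOn F a x f) e (map F y b w) := rfl

lemma isWeakHomotopyEquiv_map {D : TopCategory O} {F : C ⟶ D}
    (hF : ∀ a b, IsWeakHomotopyEquiv (mapOn F a b)) (a b : O) :
    IsWeakHomotopyEquiv (map (Γ := Γ) F a b) :=
  .sigmaCongr fun s => WordOfShape.isWeakHomotopyEquiv_map hF b s a

lemma testContinuous_mul (a b c : O) :
    TestContinuous fun p : Word Γ C a b × Word Γ C b c => mul p.1 p.2 :=
  TestContinuous.sigma_prod fun s t =>
    (continuous_sigmaMk (σ := fun s => WordOfShape Γ C s a c)).testContinuous.comp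
      (WordOfShape.testContinuous_mul t s a)

lemma closedTestEqualizers (a b : O) : ClosedTestEqualizers (Word Γ C a b) :=
  ClosedTestEqualizers.sigma fun s => WordOfShape.closedTestEqualizers s a b

section eval

variable {D : TopCategory O} (φ : C ⟶ D) (ψ : Γ ⟶ (forget O).obj D)

/-- The product in `D` of the images of the letters of a word. -/
def eval {a b : O} (w : Word Γ C a b) : D.Map a b := w.2.eval φ ψ

@[simp] lemma eval_base {a b : O} (f : C.Map a b) :
    eval φ ψ (base f) = mapOn φ a b f := rfl

@[simp] lemma eval_cons {a b x y : O} (f : C.Map a x) (e : Γ.Map x y) (w : Word Γ C y b) :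
    eval φ ψ (cons f e w) =
      D.comp (mapOn φ a x f) (D.comp (edgeMap ψ x y e) (eval φ ψ w)) := rfl

lemma eval_lmul {a b c : O} (f : C.Map a b) (w : Word Γ C b c) :
    eval φ ψ (lmul f w) = D.comp (mapOn φ a b f) (eval φ ψ w) := by
  induction w using induction <;> simp [mapOn_comp, D.assoc]

lemma eval_mul {a b c : O} (w : Word Γ C a b) (v : Word Γ C b c) :
    eval φ ψ (mul w v) = D.comp (eval φ ψ w) (eval φ ψ v) := by
  induction w using induction <;> simp_all [eval_lmul, D.assoc]

lemma testContinuous_eval (a b : O) :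
    TestContinuous fun w : Word Γ C a b => eval φ ψ w :=
  TestContinuous.sigma fun s => WordOfShape.testContinuous_eval φ ψ s a

end eval

end Word

/-! ### The free product with a free topological category -/

/-- The free product of `C` with the free topological category on `Γ`: its morphisms are words. -/
def wordCategory (Γ : TopGraph O) (C : TopCategory O) : TopCategory O where
  Map a b := Kification (Word Γ C a b)
  wh a b := (Kification.closedTestEqualizers
    (Word.closedTestEqualizers a b)).weaklyHausdorffSpace
  one a := Kification.ofBase (Word.base (C.one a))
  comp w v := Kification.ofBase (Word.mul w.toBase v.toBase)
  one_comp w := Word.one_lmul w.toBase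
  comp_one w := Word.mul_one w.toBase
  assoc w v x := Word.mul_assoc w.toBase v.toBase x.toBase
  continuous_comp a b c := kContinuous_iff.2 <|
    (Kification.testContinuous_ofBase.comp (Word.testContinuous_mul a b c)).comp
      (Kification.continuous_toBase.prodMap Kification.continuous_toBase).testContinuous

namespace wordCategory

/-- The morphism given by a word. -/
def ofWord {a b : O} (w : Word Γ C a b) : (wordCategory Γ C).Map a b := Kification.ofBase w

/-- The word underlying a morphism. -/
def toWord (a b : O) : C((wordCategory Γ C).Map a b, Word Γ C a b) :=
  (⟨Kification.toBase, Kification.continuous_toBase⟩ : C(Kification (Word Γ C a b), _))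

lemma comp_ofWord {a b c : O} (w : Word Γ C a b) (v : Word Γ C b c) :
    (wordCategory Γ C).comp (ofWord w) (ofWord v) = ofWord (Word.mul w v) := rfl

/-- The inclusion of `C` in the category of words. -/
def inclCategory (Γ : TopGraph O) (C : TopCategory O) : C ⟶ wordCategory Γ C :=
  Hom.mk
    (TopGraph.Hom.mk fun a b => ⟨fun f => Kification.ofBase (Word.base f),
      (Kification.testContinuous_ofBase.comp
        (Word.continuous_base a b).testContinuous).continuous⟩)
    (fun _ => rfl) (fun _ _ => rfl)

/-- The inclusion of `Γ` in the category of words. -/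
def inclGraph (Γ : TopGraph O) (C : TopCategory O) : Γ ⟶ (forget O).obj (wordCategory Γ C) :=
  TopGraph.Hom.mk fun a b =>
    ⟨fun e => Kification.ofBase (Word.cons (C.one a) e (Word.base (C.one b))),
      (Kification.testContinuous_ofBase.comp
        (Word.continuous_cons_base (C.one a) (C.one b)).testContinuous).continuous⟩

variable {D : TopCategory O}

/-- The morphism out of the category of words given by its restrictions to `C` and `Γ`. -/
def lift (φ : C ⟶ D) (ψ : Γ ⟶ (forget O).obj D) : wordCategory Γ C ⟶ D :=
  Hom.mk
    (TopGraph.Hom.mk fun a b => ⟨fun w => Word.eval φ ψ w.toBase,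
      Kification.continuous_of (X := Word Γ C a b) (Word.testContinuous_eval φ ψ a b)⟩)
    (fun a => mapOn_one φ a) (fun w v => Word.eval_mul φ ψ w.toBase v.toBase)

lemma inclCategory_lift (φ : C ⟶ D) (ψ : Γ ⟶ (forget O).obj D) :
    inclCategory Γ C ≫ lift φ ψ = φ :=
  hom_ext fun _ _ _ => rfl

lemma inclGraph_lift (φ : C ⟶ D) (ψ : Γ ⟶ (forget O).obj D) :
    inclGraph Γ C ≫ (forget O).map (lift φ ψ) = ψ := by
  refine TopGraph.Hom.ext ?_
  funext a b
  refine ContinuousMap.ext fun e => ?_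
  change Word.eval φ ψ (Word.cons (C.one a) e (Word.base (C.one b))) = _
  simp only [Word.eval_cons, Word.eval_base, mapOn_one, D.one_comp, D.comp_one]
  rfl

/-- Words are composites of letters from `C` and `Γ`, so any morphism is recovered by `lift` from
its two restrictions. -/
lemma hom_ext {F G : wordCategory Γ C ⟶ D}
    (h₁ : inclCategory Γ C ≫ F = inclCategory Γ C ≫ G)
    (h₂ : inclGraph Γ C ≫ (forget O).map F = inclGraph Γ C ≫ (forget O).map G) : F = G := by
  have key : ∀ H : wordCategory Γ C ⟶ D,
      H = lift (inclCategory Γ C ≫ H) (inclGraph Γ C ≫ (forget O).map H) := by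
    intro H
    refine TopCategory.hom_ext fun a b w => ?_
    obtain ⟨w, rfl⟩ : ∃ v : Word Γ C a b, ofWord v = w := ⟨w, rfl⟩
    change mapOn H a b (ofWord w) = Word.eval _ _ w
    induction w using Word.induction with
    | base f => rfl
    | @cons a x y f e w ih =>
      rw [Word.eval_cons, ← ih]
      -- `cons f e w` factors as `f`, then the edge `e` padded by identities, then `w`.
      change _ = D.comp (mapOn H a x (ofWord (Word.base f)))
        (D.comp (mapOn H x y (ofWord (Word.cons (C.one x) e (Word.base (C.one y)))))
          (mapOn H y b (ofWord w)))
      rw [← mapOn_comp, ← mapOn_comp, comp_ofWord, comp_ofWord]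
      simp [C.comp_one]
  rw [key F, key G, h₁, h₂]

/-- The morphism of categories of words induced by a morphism of topological categories. -/
def map (Γ : TopGraph O) (F : C ⟶ D) : wordCategory Γ C ⟶ wordCategory Γ D :=
  lift (F ≫ inclCategory Γ D) (inclGraph Γ D)

/-- Identifies the morphism given by the universal property with the letterwise map, whose homotopy
type is understood. -/
lemma mapOn_map (F : C ⟶ D) (a b : O) (w : Word Γ C a b) :
    mapOn (map Γ F) a b (ofWord w) = ofWord (Word.map F a b w) := by
  change Word.eval (F ≫ inclCategory Γ D) (inclGraph Γ D) w = _
  induction w using Word.induction with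
  | base f => rfl
  | @cons a x y f e w ih =>
    rw [Word.eval_cons, ih]
    change Word.mul (Word.base (mapOn F a x f)) (Word.mul
      (Word.cons (D.one x) e (Word.base (D.one y))) (Word.map F y b w)) =
        Word.map F a b (Word.cons f e w)
    simp [D.comp_one]

end wordCategory

end TopCategory

/-! ### Weak equivalences between categories of words -/

namespace Kification

variable {X : Type u} [TopologicalSpace X]

/-- Homotopy groups only see maps from cubes and their homotopies, whose domains are compact
Hausdorff; such maps are continuous into either topology. -/
lemma isWeakHomotopyEquiv_toBase :
    IsWeakHomotopyEquiv (⟨toBase, continuous_toBase⟩ : C(Kification X, X)) :=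
  .of_lift ofBase (fun _ => rfl) (fun _ => rfl) fun _ _ _ _ _ hg =>
    testContinuous_ofBase.comp_small hg

end Kification

namespace TopCategory

variable {O : Type u} {C D E : TopCategory O}

/-- For functors that are the identity on objects, the condition on `π₀` is automatic. -/
lemma isWeakEquiv_of_map {F : C ⟶ D} (h : ∀ a b, IsWeakHomotopyEquiv (mapOn F a b)) :
    IsWeakEquiv F where
  map := h
  piZero :=
    { faithful := ⟨fun {a b} _ _ hfg => (h a.obj b.obj).1.1 hfg⟩
      full := ⟨fun {a b} f => (h a.obj b.obj).1.2 f⟩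
      essSurj := ⟨fun d => ⟨⟨d.obj⟩, ⟨Iso.refl _⟩⟩⟩ }

lemma IsWeakEquiv.comp {F : C ⟶ D} {G : D ⟶ E} (hF : IsWeakEquiv F) (hG : IsWeakEquiv G) :
    IsWeakEquiv (F ≫ G) :=
  isWeakEquiv_of_map fun a b => (hG.map a b).comp (hF.map a b)

lemma isWeakEquiv_of_iso (e : C ≅ D) : IsWeakEquiv e.hom :=
  isWeakEquiv_of_map fun a b => .of_homeomorph
    { toFun := mapOn e.hom a b
      invFun := mapOn e.inv a b
      left_inv := fun x => congrArg (fun F => mapOn F a b x) e.hom_inv_id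
      right_inv := fun x => congrArg (fun F => mapOn F a b x) e.inv_hom_id
      continuous_toFun := (mapOn e.hom a b).continuous
      continuous_invFun := (mapOn e.inv a b).continuous }

lemma wordCategory.isWeakHomotopyEquiv_toWord {Γ : TopGraph O} (a b : O) :
    IsWeakHomotopyEquiv (toWord (Γ := Γ) (C := C) a b) :=
  Kification.isWeakHomotopyEquiv_toBase (X := Word Γ C a b)

lemma wordCategory.isWeakEquiv_map (Γ : TopGraph O) {F : C ⟶ D} (hF : IsWeakEquiv F) :
    IsWeakEquiv (map Γ F) := by
  refine isWeakEquiv_of_map fun a b => ?_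
  -- A commutative square whose vertical maps are weak equivalences reduces the claim to plain
  -- words.
  have he : (toWord a b).comp (mapOn (map Γ F) a b) = (Word.map F a b).comp (toWord a b) :=
    ContinuousMap.ext fun w => mapOn_map F a b (toWord a b w)
  refine .of_comp_left (isWeakHomotopyEquiv_toWord a b) ?_
  rw [he]
  exact (Word.isWeakHomotopyEquiv_map hF.map a b).comp (isWeakHomotopyEquiv_toWord a b)

/-! ### Free topological categories -/

/-- The topological category with only identity morphisms. -/
def discrete (O : Type u) : TopCategory O where
  Map a b := ULift.{u} (PLift (a = b))
  top _ _ := ⊥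
  cg a b := by
    let _ : TopologicalSpace (ULift.{u} (PLift (a = b))) := ⊥
    have : DiscreteTopology (ULift.{u} (PLift (a = b))) := ⟨rfl⟩
    infer_instance
  wh a b := by
    let _ : TopologicalSpace (ULift.{u} (PLift (a = b))) := ⊥
    have : DiscreteTopology (ULift.{u} (PLift (a = b))) := ⟨rfl⟩
    exact ⟨fun _ _ => isClosed_discrete _⟩
  one _ := ⟨⟨rfl⟩⟩
  comp f g := ⟨⟨f.down.down.trans g.down.down⟩⟩
  one_comp _ := rfl
  comp_one _ := rfl
  assoc _ _ _ := rfl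
  continuous_comp a b c := by
    let _ : ∀ a b : O, TopologicalSpace (ULift.{u} (PLift (a = b))) := fun _ _ => ⊥
    have : ∀ a b : O, DiscreteTopology (ULift.{u} (PLift (a = b))) := fun _ _ => ⟨rfl⟩
    exact kContinuous_iff.2 (Continuous.testContinuous continuous_of_discreteTopology)

/-- The unique morphism from the discrete category. -/
def fromDiscrete (D : TopCategory O) : discrete O ⟶ D :=
  Hom.mk
    (TopGraph.Hom.mk fun a _ => ⟨fun h => h.down.down ▸ D.one a, continuous_bot⟩)
    (fun _ => rfl)
    (by
      rintro a b c ⟨⟨rfl⟩⟩ ⟨⟨rfl⟩⟩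
      exact (D.one_comp _).symm)

lemma discrete_hom_ext (F G : discrete O ⟶ D) : F = G := by
  refine hom_ext ?_
  rintro a b ⟨⟨rfl⟩⟩
  exact (mapOn_one F a).trans (mapOn_one G a).symm

/-- Morphisms from the category of words over the discrete category are morphisms of graphs. -/
def freeHomEquiv (Γ : TopGraph O) (D : TopCategory O) :
    (wordCategory Γ (discrete O) ⟶ D) ≃ (Γ ⟶ (forget O).obj D) where
  toFun F := wordCategory.inclGraph Γ _ ≫ (forget O).map F
  invFun ψ := wordCategory.lift (fromDiscrete D) ψ
  left_inv _ := wordCategory.hom_ext (discrete_hom_ext _ _) (wordCategory.inclGraph_lift _ _)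
  right_inv ψ := wordCategory.inclGraph_lift _ ψ

/-- The discrete category is initial, so its free product with a free category is that free
category. -/
lemma isRightAdjoint_forget (O : Type u) : (forget O).IsRightAdjoint :=
  (Adjunction.adjunctionOfEquivLeft freeHomEquiv fun Γ _ _ g h =>
    (Category.assoc (wordCategory.inclGraph Γ _) ((forget O).map h)
      ((forget O).map g)).symm).isRightAdjoint

/-! ### The coproduct with an arbitrary left adjoint -/

section FreeProduct

variable {L : TopGraph O ⥤ TopCategory O} (adj : L ⊣ forget O) (Γ : TopGraph O)

/-- The category of words as a cofan under `L(Γ)` and `C`. -/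
def wordCofan (C : TopCategory O) : BinaryCofan (L.obj Γ) C :=
  BinaryCofan.mk ((adj.homEquiv Γ _).symm (wordCategory.inclGraph Γ C))
    (wordCategory.inclCategory Γ C)

/-- The category of words is the free product of `L(Γ)` and `C`. -/
def isColimitWordCofan (C : TopCategory O) : IsColimit (wordCofan adj Γ C) :=
  BinaryCofan.isColimitMk
    (fun s => wordCategory.lift s.inr (adj.homEquiv Γ _ s.inl))
    (fun s => (adj.homEquiv_naturality_right_symm _ _).symm.trans
      ((congrArg _ (wordCategory.inclGraph_lift _ _)).trans
        ((adj.homEquiv Γ _).symm_apply_apply _)))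
    (fun s => wordCategory.inclCategory_lift _ _)
    (fun s m h₁ h₂ => by
      refine wordCategory.hom_ext ?_ ?_
      · exact h₂.trans (wordCategory.inclCategory_lift _ _).symm
      · refine Eq.trans ?_ (wordCategory.inclGraph_lift _ _).symm
        rw [← h₁]
        exact ((adj.homEquiv_naturality_right _ m).trans
          (congrArg (· ≫ (forget O).map m) ((adj.homEquiv Γ _).apply_symm_apply _))).symm)

end FreeProduct

end TopCategory

/-- `L` is the free topological category functor (the left adjoint of the forgetful functor), and
the free product is the coproduct of topological categories with set of objects `O`. -/
theorem mainTheorem9 (O : Type u) :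
    (TopCategory.forget O).IsRightAdjoint ∧
    ∀ (L : TopGraph O ⥤ TopCategory O) (_ : L ⊣ TopCategory.forget O)
      (Γ : TopGraph O) (C D : TopCategory O) (F : C ⟶ D), TopCategory.IsWeakEquiv F →
      HasBinaryCoproduct (L.obj Γ) C ∧ HasBinaryCoproduct (L.obj Γ) D ∧
      ∀ (P : BinaryCofan (L.obj Γ) C) (hP : IsColimit P)
        (Q : BinaryCofan (L.obj Γ) D) (_ : IsColimit Q),
        TopCategory.IsWeakEquiv (BinaryCofan.IsColimit.desc hP Q.inl (F ≫ Q.inr)) := by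
  refine ⟨TopCategory.isRightAdjoint_forget O, fun L adj Γ C D F hF =>
    ⟨⟨⟨_, TopCategory.isColimitWordCofan adj Γ C⟩⟩, ⟨⟨_, TopCategory.isColimitWordCofan adj Γ D⟩⟩,
      fun P hP Q hQ => ?_⟩⟩
  let hC := TopCategory.isColimitWordCofan adj Γ C
  let hD := TopCategory.isColimitWordCofan adj Γ D
  let i := hP.coconePointUniqueUpToIso hC
  let j := hD.coconePointUniqueUpToIso hQ
  have hi₁ : P.inl ≫ i.hom = (TopCategory.wordCofan adj Γ C).inl :=
    hP.comp_coconePointUniqueUpToIso_hom hC ⟨.left⟩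
  have hi₂ : P.inr ≫ i.hom = (TopCategory.wordCofan adj Γ C).inr :=
    hP.comp_coconePointUniqueUpToIso_hom hC ⟨.right⟩
  have hj₁ : (TopCategory.wordCofan adj Γ D).inl ≫ j.hom = Q.inl :=
    hD.comp_coconePointUniqueUpToIso_hom hQ ⟨.left⟩
  have hj₂ : (TopCategory.wordCofan adj Γ D).inr ≫ j.hom = Q.inr :=
    hD.comp_coconePointUniqueUpToIso_hom hQ ⟨.right⟩
  have hw₁ : (TopCategory.wordCofan adj Γ C).inl ≫ TopCategory.wordCategory.map Γ F =
      (TopCategory.wordCofan adj Γ D).inl := by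
    refine (adj.homEquiv_naturality_right_symm _ _).symm.trans ?_
    exact congrArg _ (TopCategory.wordCategory.inclGraph_lift _ _)
  have hw₂ : (TopCategory.wordCofan adj Γ C).inr ≫ TopCategory.wordCategory.map Γ F =
      F ≫ (TopCategory.wordCofan adj Γ D).inr :=
    TopCategory.wordCategory.inclCategory_lift _ _
  have comp_eq {A P W W' Q : TopCategory O} {p : A ⟶ P} {i : P ⟶ W} {w : A ⟶ W} {m : W ⟶ W'}
      {w' : A ⟶ W'} {j : W' ⟶ Q} {q : A ⟶ Q} (h₁ : p ≫ i = w) (h₂ : w ≫ m = w')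
      (h₃ : w' ≫ j = q) : q = p ≫ i ≫ m ≫ j := by
    rw [← h₃, ← h₂, ← h₁, Category.assoc, Category.assoc]
  -- Up to the canonical isomorphisms, the induced morphism is the map of word categories; this is
  -- checked on the two coproduct legs.
  have key : BinaryCofan.IsColimit.desc hP Q.inl (F ≫ Q.inr) =
      i.hom ≫ TopCategory.wordCategory.map Γ F ≫ j.hom := by
    refine BinaryCofan.IsColimit.hom_ext hP ?_ ?_
    · exact (BinaryCofan.IsColimit.inl_desc hP _ _).trans (comp_eq hi₁ hw₁ hj₁)
    · exact (BinaryCofan.IsColimit.inr_desc hP _ _).trans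
        (comp_eq hi₂ hw₂ ((Category.assoc _ _ _).trans (congrArg (F ≫ ·) hj₂)))
  rw [key]
  exact (TopCategory.isWeakEquiv_of_iso i).comp
    ((TopCategory.wordCategory.isWeakEquiv_map Γ hF).comp (TopCategory.isWeakEquiv_of_iso j))
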